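/- Let $(Q,+,\cdot,<)$ be an ordered field, let $B$ be a set (of bodies) with subsets $IOb$ (inertial observers) and $Ph$ (light signals), and let $W\subseteq B\times B\times Q^4$ be a relation; $W(o,b,\bar x)$ means that observer $o$ coordinatizes body $b$ at $\bar x=(x_1,x_2,x_3,x_4)$, where $x_4$ is the time coordinate. Put $$ev_o(\bar x)=\{b: W(o,b,\bar x)\},\qquad wline_o(b)=\{\bar x: W(o,b,\bar x)\},$$ $$dist(\bar x,\bar y)=\sqrt{(x_1-y_1)^2+(x_2-y_2)^2+(x_3-y_3)^2},\qquad time(\bar x,\bar y)=|x_4-y_4|,$$ and write $w_{oo'}(\bar x)=\bar x'$ if $ev_o(\bar x)=ev_{o'}(\bar x')$. If $wline_o(b)$ is contained in a line, we write $v_o(b)=v$ if there are distinct $\bar x,\bar y\in wline_o(b)$ with $dist(\bar x,\bar y)=v\cdot time(\bar x,\bar y)$. Assume $SpecRel_0$, that is: * $AxEField$: every positive element of $Q$ is a square; * $AxPh$: for every $i\in IOb$ there is $c_i\in Q$ such that for all $\bar x,\bar y\in Q^4$, some $p\in Ph$ satisfies $\bar x,\bar y\in wline_i(p)$ if and only if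 $dist(\bar x,\bar y)=c_i\cdot time(\bar x,\bar y)$; * $AxEv$: for all $i,i'\in IOb$ and $\bar x\in Q^4$ there is $\bar x'\in Q^4$ with $ev_i(\bar x)=ev_{i'}(\bar x')$; * $AxSelf$: for all $i\in IOb$, $\bar x\in wline_i(i)$ if and only if $x_1=x_2=x_3=0$. Assume moreover the two symmetry axioms: * $AxSymTime$: for all $i,i'\in IOb$ and $t\in Q$, $time\big(w_{ii'}(t\cdot\bar 1_t),w_{ii'}(\bar o)\big)=time\big(w_{i'i}(t\cdot\bar 1_t),w_{i'i}(\bar o)\big)$, where $\bar o=(0,0,0,0)$ and $\bar 1_t=(0,0,0,1)$ (for all values of the relations $w_{ii'}$, $w_{i'i}$ at these points); * $AxSymDist$: for all $i,i'\in IOb$ and $\bar x,\bar y,\bar x',\bar y'\in Q^4$ with $ev_i(\bar x)=ev_{i'}(\bar x')$, $ev_i(\bar y)=ev_{i'}(\bar y')$, $time(\bar x,\bar y)=0$ and $time(\bar x',\bar y')=0$, we have $dist(\bar x,\bar y)=dist(\bar x',\bar y')$. Then all inertial observers agree on the speed of light, $Ax(c_i=c_j)$: for all $i,j\in IOb$ and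 $p\in Ph$, $v_i(p)=v_j(p)$ whenever both speeds are defined. Moreover, one and the same $c\in Q$ can be taken as $c_i$ in $AxPh$ for all $i\in IOb$. -/

import Mathlib

/-- A structure for the two-sorted language of bodies `B` and quantities `Q`: the inertial
observers `IOb`, the light signals `Ph`, and the worldview relation, where `W o b x` says that
observer `o` coordinatizes body `b` at the coordinate point `x`. The coordinates `x 0, x 1, x 2`
are spatial and `x 3` is the time. -/
structure WorldviewModel (B Q : Type*) where
  IOb : Set B
  Ph : Set B
  W : B → B → (Fin 4 → Q) → Prop

namespace WorldviewModel

section Quantities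

variable {Q : Type*} [Field Q] [LinearOrder Q] [IsStrictOrderedRing Q]

open Classical in
/-- The nonnegative square root of `a` (with value `0` if there is none). -/
noncomputable def qsqrt (a : Q) : Q :=
  if h : ∃ r : Q, 0 ≤ r ∧ r ^ 2 = a then h.choose else 0

/-- Spatial distance of two coordinate points. -/
noncomputable def spaceDist (x y : Fin 4 → Q) : Q :=
  qsqrt ((x 0 - y 0) ^ 2 + (x 1 - y 1) ^ 2 + (x 2 - y 2) ^ 2)

/-- Time difference of two coordinate points. -/
def timeDiff (x y : Fin 4 → Q) : Q := |x 3 - y 3|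

end Quantities

variable {B Q : Type*} [Field Q] [LinearOrder Q] [IsStrictOrderedRing Q]

/-- The event coordinatized by `o` at `x`. -/
def ev (M : WorldviewModel B Q) (o : B) (x : Fin 4 → Q) : Set B := {b | M.W o b x}

/-- The worldline of `b` according to `o`. -/
def wline (M : WorldviewModel B Q) (o b : B) : Set (Fin 4 → Q) := {x | M.W o b x}

/-- The worldview transformation, a binary relation: `w_{oo'}(x) = x'`. -/
def wvt (M : WorldviewModel B Q) (o o' : B) (x x' : Fin 4 → Q) : Prop := M.ev o x = M.ev o' x'

/-- `v_o(b) = v`: the worldline of `b` according to `o` lies on a line, and `v` is the ratio of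
spatial distance and time difference for two distinct points of it. -/
def HasSpeed (M : WorldviewModel B Q) (o b : B) (v : Q) : Prop :=
  Collinear Q (M.wline o b) ∧
    ∃ x ∈ M.wline o b, ∃ y ∈ M.wline o b, x ≠ y ∧ spaceDist x y = v * timeDiff x y

/-- According to `i`, two coordinate points can be connected by a light signal exactly if the
corresponding speed is `c`. -/
def IsLightSpeed (M : WorldviewModel B Q) (i : B) (c : Q) : Prop :=
  ∀ x y : Fin 4 → Q,
    (∃ p ∈ M.Ph, x ∈ M.wline i p ∧ y ∈ M.wline i p) ↔ spaceDist x y = c * timeDiff x y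

def AxPh (M : WorldviewModel B Q) : Prop := ∀ i ∈ M.IOb, ∃ c : Q, M.IsLightSpeed i c

/-- The ordered field of quantities is Euclidean (that it is an ordered field is carried by the
type class arguments). -/
def AxEField (_M : WorldviewModel B Q) : Prop := ∀ a : Q, 0 < a → ∃ r : Q, a = r ^ 2

def AxEv (M : WorldviewModel B Q) : Prop :=
  ∀ i ∈ M.IOb, ∀ i' ∈ M.IOb, ∀ x : Fin 4 → Q, ∃ x' : Fin 4 → Q, M.ev i x = M.ev i' x'

def AxSelf (M : WorldviewModel B Q) : Prop :=
  ∀ i ∈ M.IOb, ∀ x : Fin 4 → Q, x ∈ M.wline i i ↔ x 0 = 0 ∧ x 1 = 0 ∧ x 2 = 0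

structure SpecRel₀ (M : WorldviewModel B Q) : Prop where
  axPh : M.AxPh
  axEField : M.AxEField
  axEv : M.AxEv
  axSelf : M.AxSelf

def AxSymDist (M : WorldviewModel B Q) : Prop :=
  ∀ i ∈ M.IOb, ∀ i' ∈ M.IOb, ∀ x y x' y' : Fin 4 → Q,
    M.ev i x = M.ev i' x' → M.ev i y = M.ev i' y' → timeDiff x y = 0 → timeDiff x' y' = 0 →
      spaceDist x y = spaceDist x' y'

/-- `timeDiff (w_{ii'}(t·1_t), w_{ii'}(o)) = timeDiff (w_{i'i}(t·1_t), w_{i'i}(o))` for all `t`, where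
`1_t = (0,0,0,1)` and `o` is the origin; `a, b` and `a', b'` are the values of the worldview
transformations. -/
def AxSymTime (M : WorldviewModel B Q) : Prop :=
  ∀ i ∈ M.IOb, ∀ i' ∈ M.IOb, ∀ t : Q, ∀ a b a' b' : Fin 4 → Q,
    M.wvt i i' (t • ![0, 0, 0, 1]) a → M.wvt i i' 0 b →
    M.wvt i' i (t • ![0, 0, 0, 1]) a' → M.wvt i' i 0 b' →
      timeDiff a b = timeDiff a' b'

/-- `v_i(p) = v_j(p)` for all inertial observers `i`, `j` and light signals `p`; a light signal
whose worldline has fewer than two points has no speed. -/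
def AxLightSpeedEq (M : WorldviewModel B Q) : Prop :=
  ∀ i ∈ M.IOb, ∀ j ∈ M.IOb, ∀ p ∈ M.Ph, ∀ v v' : Q,
    M.HasSpeed i p v → M.HasSpeed j p v' → v = v'

end WorldviewModel

/-! If two observers have positive light speeds `c` and `c'`, the worldview transformation is a
bijection `f` of `Q⁴` matching their light cones. As in the Alexandrov–Zeeman theorem, `f` is
additive up to a translation (`image_add`), and its additive part carries the form `mink c` to `mink
c'` up to an additive map `ψ` of `Q` (`exists_mink_map_eq`). A spatial vector orthogonal to the
preimage `w` of the time unit `e` has a spatial image, so `AxSymDist` forces `ψ = id`. Pairing `e`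
with `w` then gives `c' ^ 2 * |(L e) 3| = c ^ 2 * |w 3|`, where `L` is the additive part.
`AxSymTime` equates the two absolute values, so `c = c'` (`PreservesNull.sq_eq_sq`).

`AxPh` also admits `c ≤ 0`. Light connection is transitive exactly in that case, so observers agree
on whether `c` is positive. `AxSymTime` separates `c = 0` from `c < 0`, and all negative values are
interchangeable. -/

namespace WorldviewModel

/-! ### The Minkowski form and its null vectors. -/

section MinkowskiForm

variable {Q : Type*} [Field Q] {c : Q}

/-- The Minkowski form on `Q⁴` belonging to the speed of light `c`. -/
def mink (c : Q) (x y : Fin 4 → Q) : Q :=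
  x 0 * y 0 + x 1 * y 1 + x 2 * y 2 - c ^ 2 * (x 3 * y 3)

theorem mink_comm (x y : Fin 4 → Q) : mink c x y = mink c y x := by
  simp only [mink]; ring

theorem mink_add_left (x y z : Fin 4 → Q) : mink c (x + y) z = mink c x z + mink c y z := by
  simp only [mink, Pi.add_apply]; ring

theorem mink_sub_left (x y z : Fin 4 → Q) : mink c (x - y) z = mink c x z - mink c y z := by
  simp only [mink, Pi.sub_apply]; ring

theorem mink_smul_left (r : Q) (x z : Fin 4 → Q) : mink c (r • x) z = r * mink c x z := by
  simp only [mink, Pi.smul_apply, smul_eq_mul]; ring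

theorem mink_neg_left (x z : Fin 4 → Q) : mink c (-x) z = -mink c x z := by
  simp only [mink, Pi.neg_apply]; ring

theorem mink_zero_left (z : Fin 4 → Q) : mink c 0 z = 0 := by simp [mink]

theorem mink_add_right (x y z : Fin 4 → Q) : mink c x (y + z) = mink c x y + mink c x z := by
  simp only [mink, Pi.add_apply]; ring

theorem mink_sub_right (x y z : Fin 4 → Q) : mink c x (y - z) = mink c x y - mink c x z := by
  simp only [mink, Pi.sub_apply]; ring

theorem mink_smul_right (r : Q) (x z : Fin 4 → Q) : mink c x (r • z) = r * mink c x z := by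
  simp only [mink, Pi.smul_apply, smul_eq_mul]; ring

theorem mink_neg_right (x z : Fin 4 → Q) : mink c x (-z) = -mink c x z := by
  simp only [mink, Pi.neg_apply]; ring

theorem mink_zero_right (z : Fin 4 → Q) : mink c z 0 = 0 := by simp [mink]

theorem mink_sub_self (x y : Fin 4 → Q) :
    mink c (x - y) (x - y) = mink c x x - 2 * mink c x y + mink c y y := by
  simp only [mink, Pi.sub_apply]; ring

theorem mink_self_eq_of_time_eq_zero {x : Fin 4 → Q} (h : x 3 = 0) :
    mink c x x = x 0 ^ 2 + x 1 ^ 2 + x 2 ^ 2 := by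
  simp only [mink, h]; ring

/-- A nonzero purely spatial vector orthogonal to two given ones. -/
theorem exists_spatial_orthogonal (c : Q) (u v : Fin 4 → Q) :
    ∃ s : Fin 4 → Q, s ≠ 0 ∧ s 3 = 0 ∧ mink c s u = 0 ∧ mink c s v = 0 := by
  let φ : (Fin 4 → Q) →ₗ[Q] (Fin 3 → Q) :=
    { toFun := fun s => ![s 3, mink c s u, mink c s v]
      map_add' := fun x y => by simp [mink_add_left]
      map_smul' := fun r x => by simp [mink_smul_left] }
  have hker : LinearMap.ker φ ≠ ⊥ := LinearMap.ker_ne_bot_of_finrank_lt (by simp)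
  obtain ⟨s, hs, hs0⟩ := (Submodule.ne_bot_iff _).1 hker
  have h : ![s 3, mink c s u, mink c s v] = 0 := hs
  exact ⟨s, hs0, by simpa using congrFun h 0, by simpa using congrFun h 1,
    by simpa using congrFun h 2⟩

variable [LinearOrder Q] [IsStrictOrderedRing Q]

theorem mink_self_nonneg {x : Fin 4 → Q} (h : x 3 = 0) : 0 ≤ mink c x x := by
  rw [mink_self_eq_of_time_eq_zero h]; positivity

theorem eq_zero_of_null {x : Fin 4 → Q} (h : x 3 = 0) (hx : mink c x x = 0) : x = 0 := by
  rw [mink_self_eq_of_time_eq_zero h] at hx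
  have h0 : x 0 = 0 := by
    have : x 0 ^ 2 = 0 := by nlinarith [sq_nonneg (x 0), sq_nonneg (x 1), sq_nonneg (x 2)]
    simpa using this
  have h1 : x 1 = 0 := by
    have : x 1 ^ 2 = 0 := by nlinarith [sq_nonneg (x 0), sq_nonneg (x 1), sq_nonneg (x 2)]
    simpa using this
  have h2 : x 2 = 0 := by
    have : x 2 ^ 2 = 0 := by nlinarith [sq_nonneg (x 0), sq_nonneg (x 1), sq_nonneg (x 2)]
    simpa using this
  funext i
  fin_cases i <;> simp [h, h0, h1, h2]

theorem mink_self_pos {x : Fin 4 → Q} (h : x 3 = 0) (hx : x ≠ 0) : 0 < mink c x x :=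
  lt_of_le_of_ne (mink_self_nonneg h) fun h' => hx (eq_zero_of_null h h'.symm)

/-- Orthogonal null vectors are parallel. -/
theorem exists_smul_of_null_of_orthogonal {l z : Fin 4 → Q} (hl : l ≠ 0) (hll : mink c l l = 0)
    (hzz : mink c z z = 0) (hlz : mink c l z = 0) : ∃ r : Q, z = r • l := by
  have h3 : l 3 ≠ 0 := fun h => hl (eq_zero_of_null h hll)
  -- Subtracting the multiple of `l` with the same time component leaves a null vector of time zero,
  -- and on these the form is definite.
  refine ⟨z 3 / l 3, sub_eq_zero.1 (eq_zero_of_null (c := c) ?_ ?_)⟩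
  · simp [h3]
  · simp only [mink_sub_left, mink_sub_right, mink_smul_left, mink_smul_right, hll, hzz,
      mink_comm z l, hlz]
    ring

/-- Every null vector has a null vector not orthogonal to it. -/
theorem exists_null_not_orthogonal (hc : c ≠ 0) {l : Fin 4 → Q} (hl : l ≠ 0)
    (hll : mink c l l = 0) : ∃ d : Fin 4 → Q, mink c d d = 0 ∧ mink c l d ≠ 0 := by
  have h3 : l 3 ≠ 0 := fun h => hl (eq_zero_of_null h hll)
  refine ⟨![-l 0, -l 1, -l 2, l 3], ?_, ?_⟩
  · rw [← hll]; simp [mink]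
  · have : mink c l ![-l 0, -l 1, -l 2, l 3] = -2 * c ^ 2 * l 3 ^ 2 := by
      simp only [mink] at hll
      simp [mink]
      linear_combination -hll
    rw [this]
    positivity

/-- The null vectors generate `Q⁴` additively. -/
theorem null_induction (hc : c ≠ 0) {P : (Fin 4 → Q) → Prop}
    (hnull : ∀ a, mink c a a = 0 → P a) (hadd : ∀ a b, P a → P b → P (a + b)) (x : Fin 4 → Q) :
    P x := by
  have h : x = ![x 0 / 2, 0, 0, x 0 / (2 * c)] + ![x 0 / 2, 0, 0, -(x 0 / (2 * c))]
      + (![0, x 1 / 2, 0, x 1 / (2 * c)] + ![0, x 1 / 2, 0, -(x 1 / (2 * c))])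
      + (![0, 0, x 2 / 2, x 2 / (2 * c)] + ![0, 0, x 2 / 2, -(x 2 / (2 * c))])
      + (![c * x 3 / 2, 0, 0, x 3 / 2] + ![-(c * x 3 / 2), 0, 0, x 3 / 2]) := by
    funext i
    fin_cases i <;> simp
  rw [h]
  refine hadd _ _ (hadd _ _ (hadd _ _ (hadd _ _ ?_ ?_) (hadd _ _ ?_ ?_)) (hadd _ _ ?_ ?_))
    (hadd _ _ ?_ ?_) <;>
  · apply hnull
    simp [mink]
    field_simp
    ring

end MinkowskiForm

/-! ### Additivity of bijections preserving lightlike separation. -/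

section NullMaps

variable {Q : Type*} [Field Q] {c c' : Q}

/-- `f` preserves and reflects lightlike separation. -/
def PreservesNull (c c' : Q) (f : (Fin 4 → Q) ≃ (Fin 4 → Q)) : Prop :=
  ∀ x y, mink c (x - y) (x - y) = 0 ↔ mink c' (f x - f y) (f x - f y) = 0

namespace PreservesNull

variable {f : (Fin 4 → Q) ≃ (Fin 4 → Q)}

theorem symm (hf : PreservesNull c c' f) : PreservesNull c' c f.symm := fun x y => by
  rw [hf]; simp

theorem null_image (hf : PreservesNull c c' f) (x : Fin 4 → Q) {a : Fin 4 → Q}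
    (ha : mink c a a = 0) : mink c' (f (x + a) - f x) (f (x + a) - f x) = 0 := by
  rw [← hf]; simpa using ha

theorem image_ne_zero (x : Fin 4 → Q) {a : Fin 4 → Q} (ha : a ≠ 0) : f (x + a) - f x ≠ 0 := by
  rw [sub_ne_zero, f.injective.ne_iff]; simpa using ha

variable [LinearOrder Q] [IsStrictOrderedRing Q]

/-- Null lines are mapped into null lines. -/
theorem exists_image_smul (hf : PreservesNull c c' f) (x : Fin 4 → Q) {a : Fin 4 → Q}
    (ha : mink c a a = 0) (ha0 : a ≠ 0) (r : Q) :
    ∃ s : Q, f (x + r • a) - f x = s • (f (x + a) - f x) := by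
  have hra : mink c (r • a) (r • a) = 0 := by simp [mink_smul_left, mink_smul_right, ha]
  have h1 := hf.null_image x ha
  have h2 := hf.null_image x hra
  -- Two null vectors whose difference is null are orthogonal, hence parallel.
  refine exists_smul_of_null_of_orthogonal (c := c') (image_ne_zero x ha0) h1 h2 ?_
  have h3 : mink c' (f (x + r • a) - f (x + a)) (f (x + r • a) - f (x + a)) = 0 := by
    rw [← hf]
    have : x + r • a - (x + a) = (r - 1) • a := by module
    rw [this, mink_smul_left, mink_smul_right, ha]; simp
  have h4 : f (x + r • a) - f (x + a) = (f (x + r • a) - f x) - (f (x + a) - f x) := by abel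
  rw [h4, mink_sub_self, h1, h2, mink_comm] at h3
  linarith

/-- Null lines are mapped onto null lines. -/
theorem exists_preimage_smul (hf : PreservesNull c c' f) (x : Fin 4 → Q) {a : Fin 4 → Q}
    (ha : mink c a a = 0) (ha0 : a ≠ 0) (s : Q) :
    ∃ r : Q, f (x + r • a) = f x + s • (f (x + a) - f x) := by
  obtain ⟨r, hr⟩ := hf.symm.exists_image_smul (f x) (hf.null_image x ha) (image_ne_zero x ha0) s
  refine ⟨r, ?_⟩
  simp only [add_sub_cancel, Equiv.symm_apply_apply, add_sub_cancel_left] at hr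
  rw [← hr]; simp

/-- Null hyperplanes are mapped into null hyperplanes. -/
theorem orthogonal_image (hf : PreservesNull c c' f) (x : Fin 4 → Q) {a z : Fin 4 → Q}
    (ha : mink c a a = 0) (ha0 : a ≠ 0) (hz : mink c (z - x) a = 0) :
    mink c' (f z - f x) (f (x + a) - f x) = 0 := by
  have hA := hf.null_image x ha
  by_cases hpar : ∃ r : Q, z - x = r • a
  · obtain ⟨r, hr⟩ := hpar
    obtain ⟨s, hs⟩ := hf.exists_image_smul x ha ha0 r
    rw [← hr, add_sub_cancel] at hs
    rw [hs, mink_smul_left, hA, mul_zero]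
  · by_contra hne
    set A := f (x + a) - f x with hAdef
    set z' := f z - f x with hz'
    -- If `z'` is not orthogonal to `A`, some point of the image line is lightlike separated from `f
    -- z`: solve for a null `z' - s • A`. Pulled back, this puts `z` on the original null line,
    -- which was excluded.
    obtain ⟨r, hr⟩ := hf.exists_preimage_smul x ha ha0 (mink c' z' z' / (2 * mink c' z' A))
    have h1 : mink c (z - (x + r • a)) (z - (x + r • a)) = 0 := by
      rw [hf, hr, ← hAdef]
      have : f z - (f x + (mink c' z' z' / (2 * mink c' z' A)) • A)
          = z' - (mink c' z' z' / (2 * mink c' z' A)) • A := by rw [hz']; abel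
      rw [this]
      simp only [mink_sub_left, mink_sub_right, mink_smul_left, mink_smul_right, hA,
        mink_comm A z']
      field_simp
      ring
    have h2 : mink c a (z - (x + r • a)) = 0 := by
      rw [← sub_sub, mink_sub_right, mink_smul_right, ha, mink_comm, hz]; simp
    obtain ⟨s, hs⟩ := exists_smul_of_null_of_orthogonal ha0 ha h1 h2
    refine hpar ⟨r + s, ?_⟩
    rw [add_smul, ← hs]; abel

theorem orthogonal_image_iff (hf : PreservesNull c c' f) (x : Fin 4 → Q) {a z : Fin 4 → Q}
    (ha : mink c a a = 0) (ha0 : a ≠ 0) :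
    mink c (z - x) a = 0 ↔ mink c' (f z - f x) (f (x + a) - f x) = 0 := by
  refine ⟨hf.orthogonal_image x ha ha0, fun h => ?_⟩
  simpa using hf.symm.orthogonal_image (f x) (hf.null_image x ha) (image_ne_zero x ha0) h

/-- Parallel null lines have parallel images. -/
theorem exists_image_translate (hf : PreservesNull c c' f) (x z : Fin 4 → Q) {a : Fin 4 → Q}
    (ha : mink c a a = 0) (ha0 : a ≠ 0) :
    ∃ r : Q, f (z + a) - f z = r • (f (x + a) - f x) := by
  have hX := hf.null_image x ha
  have hZ := hf.null_image z ha
  refine exists_smul_of_null_of_orthogonal (image_ne_zero x ha0) hX hZ ?_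
  by_cases h : mink c (z - x) a = 0
  · have h1 := hf.orthogonal_image x ha ha0 h
    have h2 : mink c' (f (z + a) - f x) (f (x + a) - f x) = 0 := by
      refine hf.orthogonal_image x ha ha0 ?_
      rw [add_sub_right_comm, mink_add_left, h, ha, add_zero]
    have : f (z + a) - f z = (f (z + a) - f x) - (f z - f x) := by abel
    rw [mink_comm, this, mink_sub_left, h1, h2, sub_zero]
  -- The null hyperplanes of the two lines are now disjoint, whereas those of the image lines would
  -- meet if `X` and `Z` were not orthogonal.
  · by_contra hne
    set X := f (x + a) - f x with hXdef
    set Z := f (z + a) - f z with hZdef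
    -- a common point of the two image hyperplanes
    set u := f z - f x with hu
    obtain ⟨p, hp⟩ := f.surjective (f x + (mink c' u Z / mink c' X Z) • X)
    have h1 : mink c (p - x) a = 0 := by
      rw [hf.orthogonal_image_iff x ha ha0, hp, ← hXdef, add_sub_cancel_left, mink_smul_left, hX,
        mul_zero]
    have h2 : mink c (p - z) a = 0 := by
      rw [hf.orthogonal_image_iff z ha ha0, hp, ← hZdef]
      have : f x + (mink c' u Z / mink c' X Z) • X - f z
          = (mink c' u Z / mink c' X Z) • X - u := by rw [hu]; abel
      rw [this, mink_sub_left, mink_smul_left]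
      field_simp
      ring
    apply h
    have : z - x = (p - x) - (p - z) := by abel
    rw [this, mink_sub_left, h1, h2, sub_zero]

/-- Opposite sides have parallel images. The images of `a` and `b` are not orthogonal, hence
independent, so comparing the two paths to the opposite corner makes both factors of proportionality
equal to 1. -/
theorem image_parallelogram (hf : PreservesNull c c' f) {a b : Fin 4 → Q} (ha : mink c a a = 0)
    (hb : mink c b b = 0) (hab : mink c a b ≠ 0) (x : Fin 4 → Q) :
    f (x + b + a) - f (x + b) = f (x + a) - f x := by
  have ha0 : a ≠ 0 := by rintro rfl; exact hab (mink_zero_left _)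
  have hb0 : b ≠ 0 := by rintro rfl; exact hab (mink_zero_right _)
  obtain ⟨r, hr⟩ := hf.exists_image_translate x (x + b) ha ha0
  obtain ⟨s, hs⟩ := hf.exists_image_translate x (x + a) hb hb0
  have hA := hf.null_image x ha
  have hB := hf.null_image x hb
  have hAB : mink c' (f (x + a) - f x) (f (x + b) - f x) ≠ 0 := by
    rw [mink_comm, Ne, ← hf.orthogonal_image_iff x ha ha0, add_sub_cancel_left, mink_comm]
    exact hab
  have key : (r - 1) • (f (x + a) - f x) = (s - 1) • (f (x + b) - f x) := by
    rw [sub_smul, sub_smul, ← hr, ← hs, add_right_comm x a b]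
    module
  have h := congrArg (fun v => mink c' v (f (x + b) - f x)) key
  simp only [mink_smul_left, hB, mul_zero, mul_eq_zero, hAB, or_false] at h
  rw [hr, sub_eq_zero.1 h, one_smul]

/-- The displacement caused by `a` does not depend on the base point: every shift `b` is a sum of
null vectors, and `image_parallelogram` treats those not orthogonal to `a`. The remaining ones are
parallel to `a` and must be decomposed further. -/
theorem image_add_null (hf : PreservesNull c c' f) (hc : c ≠ 0) {a : Fin 4 → Q}
    (ha : mink c a a = 0) (b : Fin 4 → Q) :
    ∀ x, f (x + b + a) - f (x + b) = f (x + a) - f x := by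
  refine null_induction (P := fun b => ∀ x, f (x + b + a) - f (x + b) = f (x + a) - f x) hc
    (fun b hb => ?_) (fun b b' h h' x => ?_) b
  · by_cases ha0 : a = 0
    · simp [ha0]
    by_cases hab : mink c a b = 0
    · obtain ⟨r, rfl⟩ := exists_smul_of_null_of_orthogonal ha0 ha hb hab
      by_cases hr : r = 0
      · simp [hr]
      obtain ⟨d, hd, had⟩ := exists_null_not_orthogonal hc ha0 ha
      obtain ⟨s, hs0, hs3, hsa, hsd⟩ := exists_spatial_orthogonal c a d
      have hk : mink c s s ≠ 0 := (mink_self_pos hs3 hs0).ne'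
      -- `r • a` is a sum of null vectors which are not orthogonal to `a`
      set β := -mink c s s / (r * mink c a d) with hβ
      have hβ0 : β ≠ 0 := by rw [hβ]; exact div_ne_zero (neg_ne_zero.2 hk) (mul_ne_zero hr had)
      have hβe : r * β * mink c a d = -mink c s s := by rw [hβ]; field_simp
      have has : mink c a s = 0 := by rw [mink_comm, hsa]
      have hds : mink c d s = 0 := by rw [mink_comm, hsd]
      have hda : mink c d a = mink c a d := mink_comm _ _
      -- `β` makes the first two summands null: each has square `r * β * mink c a d + mink c s s`.
      have e : r • a = ((r / 2) • a + β • d + s) + ((r / 2) • a + β • d - s)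
          + (-2 * β) • d := by
        module
      intro x
      rw [e, ← add_assoc, ← add_assoc, hf.image_parallelogram ha, hf.image_parallelogram ha,
        hf.image_parallelogram ha]
      all_goals simp only [mink_add_left, mink_add_right, mink_sub_left, mink_sub_right,
        mink_smul_left, mink_smul_right, ha, hd, hsa, hsd, has, hds, hda]
      · linear_combination hβe
      · simpa using ⟨hβ0, had⟩
      · linear_combination hβe
      · simpa using ⟨hβ0, had⟩
      · simp
      · simpa using ⟨hβ0, had⟩
    · exact hf.image_parallelogram ha hb hab
  · rw [← add_assoc, h', h]

theorem image_add (hf : PreservesNull c c' f) (hc : c ≠ 0) (x y : Fin 4 → Q) :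
    f (x + y) - f 0 = (f x - f 0) + (f y - f 0) := by
  have H : ∀ x, f (x + y) - f x = f y - f 0 := by
    refine null_induction (P := fun y => ∀ x, f (x + y) - f x = f y - f 0) hc
      (fun a ha x => ?_) (fun a b h h' x => ?_) y
    · simpa using hf.image_add_null hc ha x 0
    · have h1 := h x
      have h2 := h' (x + a)
      have h3 := h' a
      rw [← add_assoc]
      rw [sub_eq_iff_eq_add] at h1 h2 h3 ⊢
      rw [h2, h1, h3]; abel
  have := H x
  rw [sub_eq_iff_eq_add] at this
  rw [this]; abel

/-- The linear part of a map preserving lightlike separation. -/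
def linearPart (hf : PreservesNull c c' f) (hc : c ≠ 0) : (Fin 4 → Q) →+ (Fin 4 → Q) where
  toFun x := f x - f 0
  map_zero' := sub_self _
  map_add' := hf.image_add hc

end PreservesNull

end NullMaps

/-! ### Transformation of the Minkowski form and equality of the squared speeds. -/

section Isometry

variable {Q : Type*} [Field Q] [LinearOrder Q] [IsStrictOrderedRing Q] {c c' : Q}

/-- Two null vectors which are not orthogonal and have the same time orientation have prescribed
equal products with a suitable null vector. -/
theorem exists_null_of_mink_neg (hE : ∀ a : Q, 0 < a → ∃ r : Q, a = r ^ 2) {l m : Fin 4 → Q}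
    (hl : mink c l l = 0) (hm : mink c m m = 0) (hlm : mink c l m < 0) (q : Q) :
    ∃ n : Fin 4 → Q, mink c n n = 0 ∧ mink c l n = q ∧ mink c m n = q := by
  by_cases hq : q = 0
  · exact ⟨0, mink_zero_left _, by rw [hq, mink_zero_right], by rw [hq, mink_zero_right]⟩
  obtain ⟨s, hs0, hs3, hsl, hsm⟩ := exists_spatial_orthogonal c l m
  have hk : 0 < mink c s s := mink_self_pos hs3 hs0
  -- The multiple of `l + m` in the witness fixes both products and has square `2 * q ^ 2 / mink c l
  -- m`. Its negativity is what allows `r • s` to cancel it.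
  obtain ⟨r, hr⟩ := hE (2 * q ^ 2 / (-mink c l m * mink c s s))
    (div_pos (by positivity) (mul_pos (neg_pos.2 hlm) hk))
  have hls : mink c l s = 0 := by rw [mink_comm, hsl]
  have hms : mink c m s = 0 := by rw [mink_comm, hsm]
  have hml : mink c m l = mink c l m := mink_comm _ _
  have hlm0 : mink c l m ≠ 0 := hlm.ne
  have hr' : r ^ 2 * mink c s s = -(2 * q ^ 2 / mink c l m) := by
    rw [← hr]; field_simp
  refine ⟨(q / mink c l m) • l + (q / mink c l m) • m + r • s, ?_, ?_, ?_⟩ <;>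
    simp only [mink_add_left, mink_add_right, mink_smul_left, mink_smul_right, hl, hm, hsl, hsm,
      hls, hms, hml]
  · have : q / mink c l m * (q / mink c l m * mink c l m) = q ^ 2 / mink c l m := by
      field_simp
    linear_combination hr' + 2 * this
  · field_simp; ring
  · field_simp; ring

variable {L : (Fin 4 → Q) →+ (Fin 4 → Q)}

/-- For null `l`, the product of `L l` and `L z` depends only on `mink c l z`. A null `n` having
this same product with `l` and with `m` links the two sides, by symmetry of the form. If `mink c l
m` is positive, `m` and `w` are replaced by their negatives. -/
theorem mink_map_eq_of_not_orthogonal (hE : ∀ a : Q, 0 < a → ∃ r : Q, a = r ^ 2)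
    (hL : ∀ l z, mink c l l = 0 → mink c l z = 0 → mink c' (L l) (L z) = 0)
    {l m z w : Fin 4 → Q} (hl : mink c l l = 0) (hm : mink c m m = 0) (hlm : mink c l m ≠ 0)
    (h : mink c l z = mink c m w) : mink c' (L l) (L z) = mink c' (L m) (L w) := by
  have hL' : ∀ l z w, mink c l l = 0 → mink c l z = mink c l w →
      mink c' (L l) (L z) = mink c' (L l) (L w) := fun l z w hl hzw => by
    have := hL l (z - w) hl (by rw [mink_sub_right, hzw, sub_self])
    rwa [map_sub, mink_sub_right, sub_eq_zero] at this
  have key : ∀ {m w : Fin 4 → Q}, mink c m m = 0 → mink c l m < 0 → mink c l z = mink c m w →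
      mink c' (L l) (L z) = mink c' (L m) (L w) := fun {m w} hm hlm h => by
    obtain ⟨n, hn, hln, hmn⟩ := exists_null_of_mink_neg hE hl hm hlm (mink c l z)
    rw [hL' l z n hl hln.symm, hL' m w n hm (by rw [hmn, h]), mink_comm, mink_comm (L m)]
    exact hL' n l m hn (by rw [mink_comm n l, hln, mink_comm n m, hmn])
  rcases lt_or_gt_of_ne hlm with hneg | hpos
  · exact key hm hneg h
  · have := key (m := -m) (w := -w) (by simpa [mink_neg_left, mink_neg_right] using hm)
      (by simpa [mink_neg_right] using hpos) (by simpa [mink_neg_left, mink_neg_right] using h)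
    simpa [mink_neg_left, mink_neg_right] using this

theorem mink_map_eq_of_null (hE : ∀ a : Q, 0 < a → ∃ r : Q, a = r ^ 2) (hc : c ≠ 0)
    (hL : ∀ l z, mink c l l = 0 → mink c l z = 0 → mink c' (L l) (L z) = 0)
    {l m z w : Fin 4 → Q} (hl : mink c l l = 0) (hm : mink c m m = 0) (hl0 : l ≠ 0) (hm0 : m ≠ 0)
    (h : mink c l z = mink c m w) : mink c' (L l) (L z) = mink c' (L m) (L w) := by
  by_cases hlm : mink c l m = 0
  · obtain ⟨r, rfl⟩ := exists_smul_of_null_of_orthogonal hl0 hl hm hlm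
    have hr : r ≠ 0 := by rintro rfl; simp at hm0
    obtain ⟨d, hd, hld⟩ := exists_null_not_orthogonal hc hl0 hl
    have hdl : mink c d l ≠ 0 := by rwa [mink_comm]
    have hdv : mink c d ((mink c l z / mink c d l) • l) = mink c l z := by
      rw [mink_smul_right]; field_simp
    rw [mink_map_eq_of_not_orthogonal hE hL hl hd hld hdv.symm]
    refine mink_map_eq_of_not_orthogonal hE hL hd hm ?_ (by rw [hdv, h])
    rw [mink_smul_right]
    exact mul_ne_zero hr hdl
  · exact mink_map_eq_of_not_orthogonal hE hL hl hm hlm h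

/-- An additive map preserving orthogonality to null vectors transforms the Minkowski form by an
additive map of the field. -/
theorem exists_mink_map_eq (hE : ∀ a : Q, 0 < a → ∃ r : Q, a = r ^ 2) (hc : c ≠ 0)
    (hL : ∀ l z, mink c l l = 0 → mink c l z = 0 → mink c' (L l) (L z) = 0) :
    ∃ ψ : Q →+ Q, ∀ x y, mink c' (L x) (L y) = ψ (mink c x y) := by
  have hl : mink c ![c, 0, 0, 1] ![c, 0, 0, 1] = 0 := by simp [mink]; ring
  have hz : mink c ![c, 0, 0, 1] ![c⁻¹, 0, 0, 0] = 1 := by simp [mink, hc]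
  have hl0 : (![c, 0, 0, 1] : Fin 4 → Q) ≠ 0 := fun h => by simpa using congrFun h 3
  generalize (![c, 0, 0, 1] : Fin 4 → Q) = l at *
  generalize (![c⁻¹, 0, 0, 0] : Fin 4 → Q) = z at *
  -- Since `mink c l (q • z) = q`, the fixed null vector `l` realizes every value of the form. Only
  -- additivity of `ψ` is available, as `L` is merely additive.
  let ψ : Q →+ Q :=
    { toFun := fun q => mink c' (L l) (L (q • z))
      map_zero' := by simp [mink_zero_right]
      map_add' := fun p q => by rw [add_smul, map_add, mink_add_right] }
  refine ⟨ψ, fun x => ?_⟩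
  refine null_induction (P := fun x => ∀ y, mink c' (L x) (L y) = ψ (mink c x y)) hc
    (fun a ha y => ?_) (fun a b h h' y => ?_) x
  · by_cases ha0 : a = 0
    · simp [ha0, mink_zero_left]
    · exact mink_map_eq_of_null hE hc hL ha hl ha0 hl0 (by rw [mink_smul_right, hz, mul_one])
  · rw [map_add, mink_add_left, mink_add_left, map_add, h, h']

/-- A bijection of `Q⁴` that preserves lightlike separation, preserves the length of vectors which
are spatial before and after, and has reciprocal time dilation preserves the speed of light. -/
theorem PreservesNull.sq_eq_sq (hE : ∀ a : Q, 0 < a → ∃ r : Q, a = r ^ 2)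
    {f : (Fin 4 → Q) ≃ (Fin 4 → Q)} (hf : PreservesNull c c' f) (hc : c ≠ 0) (hc' : c' ≠ 0)
    (hD : ∀ x y, x 3 = y 3 → f x 3 = f y 3 →
      mink c (x - y) (x - y) = mink c' (f x - f y) (f x - f y))
    (hT : |f ![0, 0, 0, 1] 3 - f 0 3| = |f.symm ![0, 0, 0, 1] 3 - f.symm 0 3|) :
    c ^ 2 = c' ^ 2 := by
  have hLx : ∀ x, hf.linearPart hc x = f x - f 0 := fun x => rfl
  have hg : ∀ y, hf.linearPart hc (f.symm y - f.symm 0) = y := fun y => by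
    rw [map_sub, hLx, hLx]; simp
  obtain ⟨ψ, hψ⟩ := exists_mink_map_eq (L := hf.linearPart hc) (c := c) (c' := c') hE hc
    fun l z hl hlz => by
      by_cases hl0 : l = 0
      · simp [hl0, mink_zero_left]
      · have := hf.orthogonal_image 0 (z := z) hl hl0 (by rwa [sub_zero, mink_comm])
        rwa [zero_add, mink_comm] at this
  have he : ∀ (k : Q) (x : Fin 4 → Q), mink k x ![0, 0, 0, 1] = -k ^ 2 * x 3 := fun k x => by
    simp [mink]
  set w := f.symm ![0, 0, 0, 1] - f.symm 0 with hw
  have hLw : hf.linearPart hc w = ![0, 0, 0, 1] := hg _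
  -- Multiples of `s` are orthogonal to `w`, so their images are orthogonal to the time axis, i.e.
  -- spatial, and `hD` applies. Their squares exhaust the positive elements of `Q`.
  obtain ⟨s, hs0, hs3, hsw, -⟩ := exists_spatial_orthogonal c w w
  have hk : 0 < mink c s s := mink_self_pos hs3 hs0
  have hψpos : ∀ q, 0 < q → ψ q = q := fun q hq => by
    obtain ⟨r, hr⟩ := hE (q / mink c s s) (div_pos hq hk)
    have hq' : mink c (r • s) (r • s) = q := by
      rw [mink_smul_left, mink_smul_right, ← mul_assoc, ← pow_two, ← hr]
      field_simp
    have h1 : mink c' (hf.linearPart hc (r • s)) ![0, 0, 0, 1] = 0 := by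
      rw [← hLw, hψ, mink_smul_left, hsw, mul_zero, map_zero]
    rw [he, neg_mul, neg_eq_zero, mul_eq_zero, or_iff_right (pow_ne_zero 2 hc'), hLx,
      Pi.sub_apply, sub_eq_zero] at h1
    have h2 := hD (r • s) 0 (by simp [hs3]) h1
    rw [← hLx, hψ, sub_zero, hq'] at h2
    exact h2.symm
  have hψid : ∀ q, ψ q = q := fun q => by
    rcases lt_trichotomy q 0 with h | h | h
    · have := hψpos (-q) (neg_pos.2 h)
      rwa [map_neg, neg_inj] at this
    · rw [h, map_zero]
    · exact hψpos q h
  -- With time component zero, `w` would have a nonnegative square, but its square is `-c' ^ 2`.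
  have hw3 : w 3 ≠ 0 := fun h => by
    have h1 := hψ w w
    have h2 := mink_self_nonneg (c := c) h
    rw [hψid, hLw, he] at h1
    rw [← h1] at h2
    simp [hc'] at h2
  have h1 := hψ ![0, 0, 0, 1] w
  rw [hψid, hLw, he, mink_comm, he, hLx] at h1
  have h2 : c' ^ 2 * |f ![0, 0, 0, 1] 3 - f 0 3| = c ^ 2 * |w 3| := by
    have := congrArg abs h1
    simpa [abs_mul] using this
  have h3 : |f ![0, 0, 0, 1] 3 - f 0 3| = |w 3| := by rw [hT, hw]; simp
  rw [h3] at h2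
  exact (mul_right_cancel₀ (abs_ne_zero.2 hw3) h2).symm

end Isometry

/-! ### Spatial distance, time difference and their relation to the form. -/

section Distance

variable {Q : Type*} [Field Q] [LinearOrder Q] {c : Q}

theorem qsqrt_nonneg (a : Q) : 0 ≤ qsqrt a := by
  unfold qsqrt
  split_ifs with h
  · exact h.choose_spec.1
  · exact le_rfl

theorem spaceDist_nonneg (x y : Fin 4 → Q) : 0 ≤ spaceDist x y := qsqrt_nonneg _

variable [IsStrictOrderedRing Q]

theorem qsqrt_sq (hE : ∀ a : Q, 0 < a → ∃ r : Q, a = r ^ 2) {a : Q} (ha : 0 ≤ a) :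
    qsqrt a ^ 2 = a := by
  have h : ∃ r : Q, 0 ≤ r ∧ r ^ 2 = a := by
    rcases ha.eq_or_lt with rfl | ha
    · exact ⟨0, le_rfl, by simp⟩
    · obtain ⟨r, hr⟩ := hE a ha
      exact ⟨|r|, abs_nonneg r, by rw [sq_abs, hr]⟩
  rw [qsqrt, dif_pos h]
  exact h.choose_spec.2

theorem timeDiff_nonneg (x y : Fin 4 → Q) : 0 ≤ timeDiff x y := abs_nonneg _

theorem timeDiff_eq_zero_iff {x y : Fin 4 → Q} : timeDiff x y = 0 ↔ x 3 = y 3 := by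
  rw [timeDiff, abs_eq_zero, sub_eq_zero]

theorem spaceDist_sq (hE : ∀ a : Q, 0 < a → ∃ r : Q, a = r ^ 2) (x y : Fin 4 → Q) :
    spaceDist x y ^ 2 = (x 0 - y 0) ^ 2 + (x 1 - y 1) ^ 2 + (x 2 - y 2) ^ 2 :=
  qsqrt_sq hE (by positivity)

theorem mink_sub_self_eq (hE : ∀ a : Q, 0 < a → ∃ r : Q, a = r ^ 2) (c : Q) (x y : Fin 4 → Q) :
    mink c (x - y) (x - y) = spaceDist x y ^ 2 - (c * timeDiff x y) ^ 2 := by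
  rw [spaceDist_sq hE, mul_pow, timeDiff, sq_abs]
  simp only [mink, Pi.sub_apply]
  ring

theorem spaceDist_eq_iff_null (hE : ∀ a : Q, 0 < a → ∃ r : Q, a = r ^ 2) (hc : 0 ≤ c)
    (x y : Fin 4 → Q) :
    spaceDist x y = c * timeDiff x y ↔ mink c (x - y) (x - y) = 0 := by
  rw [mink_sub_self_eq hE, sub_eq_zero,
    pow_left_inj₀ (spaceDist_nonneg x y) (mul_nonneg hc (timeDiff_nonneg x y)) two_ne_zero]

theorem spaceDist_eq_zero_iff (hE : ∀ a : Q, 0 < a → ∃ r : Q, a = r ^ 2) (x y : Fin 4 → Q) :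
    spaceDist x y = 0 ↔ x 0 = y 0 ∧ x 1 = y 1 ∧ x 2 = y 2 := by
  rw [← pow_eq_zero_iff two_ne_zero, spaceDist_sq hE, add_eq_zero_iff_of_nonneg (by positivity)
    (by positivity), add_eq_zero_iff_of_nonneg (by positivity) (by positivity)]
  simp [sub_eq_zero, and_assoc]

theorem eq_of_spaceDist_of_timeDiff (hE : ∀ a : Q, 0 < a → ∃ r : Q, a = r ^ 2) {x y : Fin 4 → Q}
    (hs : spaceDist x y = 0) (ht : timeDiff x y = 0) : x = y := by
  rw [spaceDist_eq_zero_iff hE] at hs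
  rw [timeDiff_eq_zero_iff] at ht
  funext i
  fin_cases i
  exacts [hs.1, hs.2.1, hs.2.2, ht]

theorem spaceDist_eq_mul_iff_of_nonpos (hc : c ≤ 0) (x y : Fin 4 → Q) :
    spaceDist x y = c * timeDiff x y ↔ spaceDist x y = 0 ∧ c * timeDiff x y = 0 := by
  refine ⟨fun h => ?_, fun h => h.1.trans h.2.symm⟩
  have h1 := spaceDist_nonneg x y
  have h2 := mul_nonpos_of_nonpos_of_nonneg hc (timeDiff_nonneg x y)
  exact ⟨le_antisymm (h.trans_le h2) h1, le_antisymm h2 (h ▸ h1)⟩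

theorem spaceDist_eq_mul_iff_of_neg (hE : ∀ a : Q, 0 < a → ∃ r : Q, a = r ^ 2) (hc : c < 0)
    (x y : Fin 4 → Q) : spaceDist x y = c * timeDiff x y ↔ x = y := by
  rw [spaceDist_eq_mul_iff_of_nonpos hc.le, mul_eq_zero, or_iff_right hc.ne]
  refine ⟨fun h => eq_of_spaceDist_of_timeDiff hE h.1 h.2, ?_⟩
  rintro rfl
  exact ⟨(spaceDist_eq_zero_iff hE x x).2 ⟨rfl, rfl, rfl⟩, timeDiff_eq_zero_iff.2 rfl⟩

end Distance

/-! ### Light connection between events, the sign of the light speed and the conclusion. -/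

section LightSignals

variable {B Q : Type*} {M : WorldviewModel B Q} {i j : B} {c c' : Q}

/-- According to `i`, some light signal passes through both coordinate points. -/
def LightConnected (M : WorldviewModel B Q) (i : B) (x y : Fin 4 → Q) : Prop :=
  ∃ p ∈ M.Ph, x ∈ M.wline i p ∧ y ∈ M.wline i p

theorem lightConnected_congr {x y x' y' : Fin 4 → Q} (hx : M.ev i x = M.ev j x')
    (hy : M.ev i y = M.ev j y') : M.LightConnected i x y ↔ M.LightConnected j x' y' := by
  have hx' : ∀ b, M.W i b x ↔ M.W j b x' := fun b => Set.ext_iff.1 hx b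
  have hy' : ∀ b, M.W i b y ↔ M.W j b y' := fun b => Set.ext_iff.1 hy b
  simp only [LightConnected, wline, Set.mem_ofPred_eq, hx', hy']

variable [Field Q] [LinearOrder Q]

theorem IsLightSpeed.lightConnected_iff (h : M.IsLightSpeed i c) (x y : Fin 4 → Q) :
    M.LightConnected i x y ↔ spaceDist x y = c * timeDiff x y := h x y

variable [IsStrictOrderedRing Q]

/-- For `c ≤ 0` both sides of the equation in `AxPh` must vanish, which defines a transitive
relation. As light connection depends only on events, transitivity is shared by all observers. -/
theorem IsLightSpeed.lightConnected_trans (hE : ∀ a : Q, 0 < a → ∃ r : Q, a = r ^ 2)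
    (h : M.IsLightSpeed i c) (hc : c ≤ 0) {x y z : Fin 4 → Q} (hxy : M.LightConnected i x y)
    (hyz : M.LightConnected i y z) : M.LightConnected i x z := by
  rw [h.lightConnected_iff, spaceDist_eq_mul_iff_of_nonpos hc, spaceDist_eq_zero_iff hE,
    mul_eq_zero, timeDiff_eq_zero_iff] at *
  grind

theorem IsLightSpeed.exists_not_lightConnected_trans (hE : ∀ a : Q, 0 < a → ∃ r : Q, a = r ^ 2)
    (h : M.IsLightSpeed i c) (hc : 0 < c) :
    ∃ x y z, M.LightConnected i x y ∧ M.LightConnected i y z ∧ ¬ M.LightConnected i x z := by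
  refine ⟨0, ![c, 0, 0, 1], ![2 * c, 0, 0, 0], ?_, ?_, ?_⟩ <;>
    rw [h.lightConnected_iff, spaceDist_eq_iff_null hE hc.le]
  · simp [mink]; ring
  · simp [mink]; ring
  · simp [mink, hc.ne']

theorem SpecRel₀.not_pos_of_nonpos (h₀ : M.SpecRel₀) (hi : i ∈ M.IOb) (hj : j ∈ M.IOb)
    (hci : M.IsLightSpeed i c) (hcj : M.IsLightSpeed j c') (hc : c ≤ 0) : c' ≤ 0 := by
  by_contra hc'
  obtain ⟨x, y, z, hxy, hyz, hxz⟩ :=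
    hcj.exists_not_lightConnected_trans h₀.axEField (not_le.1 hc')
  obtain ⟨x', hx⟩ := h₀.axEv j hj i hi x
  obtain ⟨y', hy⟩ := h₀.axEv j hj i hi y
  obtain ⟨z', hz⟩ := h₀.axEv j hj i hi z
  rw [lightConnected_congr hx hy] at hxy
  rw [lightConnected_congr hy hz] at hyz
  rw [lightConnected_congr hx hz] at hxz
  exact hxz (hci.lightConnected_trans h₀.axEField hc hxy hyz)

theorem SpecRel₀.neg_of_neg (h₀ : M.SpecRel₀) (hT : M.AxSymTime) (hi : i ∈ M.IOb)
    (hj : j ∈ M.IOb) (hci : M.IsLightSpeed i c) (hcj : M.IsLightSpeed j c') (hc : c < 0) :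
    c' < 0 := by
  refine lt_of_le_of_ne (h₀.not_pos_of_nonpos hi hj hci hcj hc.le) ?_
  rintro rfl
  have hconn : M.LightConnected j (0 : Fin 4 → Q) ![0, 0, 0, 1] := by
    rw [hcj.lightConnected_iff, zero_mul, spaceDist_eq_zero_iff h₀.axEField]
    simp
  obtain ⟨x, hx⟩ := h₀.axEv j hj i hi 0
  obtain ⟨y, hy⟩ := h₀.axEv j hj i hi ![0, 0, 0, 1]
  rw [lightConnected_congr hx hy, hci.lightConnected_iff,
    spaceDist_eq_mul_iff_of_neg h₀.axEField hc] at hconn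
  subst hconn
  -- For `j`, the origin and the time unit now carry the same event, so the relation `M.wvt j j`
  -- also sends the time unit to the origin. Comparing this value with the identity value in
  -- `AxSymTime` gives `0 = 1`.
  have := hT j hj j hj 1 0 0 ![0, 0, 0, 1] 0 (by rw [one_smul]; exact hy.trans hx.symm) rfl
    (by rw [one_smul]; rfl) rfl
  simp [timeDiff] at this

/-- Points with the same event have the same light cone. Hence their difference is null and
orthogonal to all null vectors, so to everything, and it vanishes as the form is nondegenerate. This
makes the worldview transformation a bijection. -/
theorem IsLightSpeed.ev_injective (hE : ∀ a : Q, 0 < a → ∃ r : Q, a = r ^ 2)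
    (h : M.IsLightSpeed i c) (hc : 0 < c) : Function.Injective (M.ev i) := by
  intro x y hxy
  have hd : ∀ a, mink c a a = 0 → mink c (a - (x - y)) (a - (x - y)) = 0 := fun a ha => by
    have h1 := lightConnected_congr hxy (rfl : M.ev i (x - a) = M.ev i (x - a))
    rw [h.lightConnected_iff, h.lightConnected_iff, spaceDist_eq_iff_null hE hc.le,
      spaceDist_eq_iff_null hE hc.le, sub_sub_cancel] at h1
    have h2 := h1.1 ha
    have e : y - (x - a) = a - (x - y) := by abel
    rwa [e] at h2
  have hdd : mink c (x - y) (x - y) = 0 := by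
    have := hd 0 (mink_zero_left _)
    rwa [mink_sub_self, mink_zero_left, mink_zero_left, mul_zero, sub_zero, zero_add] at this
  have horth : ∀ z, mink c z (x - y) = 0 :=
    null_induction hc.ne' (fun a ha => by
      have := hd a ha
      rw [mink_sub_self, ha, hdd] at this
      linarith) fun a b ha hb => by rw [mink_add_left, ha, hb, add_zero]
  have h3 := horth ![0, 0, 0, 1]
  refine sub_eq_zero.1 (eq_zero_of_null (c := c) ?_ hdd)
  simpa [mink, hc.ne'] using h3

theorem SpecRel₀.eq_of_pos (h₀ : M.SpecRel₀) (hT : M.AxSymTime) (hD : M.AxSymDist)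
    (hi : i ∈ M.IOb) (hj : j ∈ M.IOb) (hci : M.IsLightSpeed i c) (hcj : M.IsLightSpeed j c')
    (hc : 0 < c) (hc' : 0 < c') : c = c' := by
  have hE := h₀.axEField
  choose F hF using h₀.axEv i hi j hj
  choose G hG using h₀.axEv j hj i hi
  let f : (Fin 4 → Q) ≃ (Fin 4 → Q) :=
    { toFun := F
      invFun := G
      left_inv := fun x => hci.ev_injective hE hc ((hG _).symm.trans (hF x).symm)
      right_inv := fun x => hcj.ev_injective hE hc' ((hF _).symm.trans (hG x).symm) }
  have hf : PreservesNull c c' f := fun x y => by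
    rw [← spaceDist_eq_iff_null hE hc.le, ← spaceDist_eq_iff_null hE hc'.le,
      ← hci.lightConnected_iff, ← hcj.lightConnected_iff]
    exact lightConnected_congr (hF x) (hF y)
  refine (pow_left_inj₀ hc.le hc'.le two_ne_zero).1
    (hf.sq_eq_sq hE hc.ne' hc'.ne' (fun x y h h' => ?_) ?_)
  · rw [← timeDiff_eq_zero_iff] at h h'
    rw [mink_sub_self_eq hE, mink_sub_self_eq hE, h, h', mul_zero, mul_zero,
      hD i hi j hj x y _ _ (hF x) (hF y) h h']
    rfl
  · exact hT i hi j hj 1 (F ![0, 0, 0, 1]) (F 0) (G ![0, 0, 0, 1]) (G 0)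
      (by rw [one_smul]; exact hF _) (hF 0) (by rw [one_smul]; exact hG _) (hG 0)

theorem SpecRel₀.exists_common_lightSpeed (h₀ : M.SpecRel₀) (hT : M.AxSymTime)
    (hD : M.AxSymDist) : ∃ c : Q, ∀ i ∈ M.IOb, M.IsLightSpeed i c := by
  rcases M.IOb.eq_empty_or_nonempty with h | ⟨i, hi⟩
  · exact ⟨0, fun i hi => by simp [h] at hi⟩
  obtain ⟨c, hc⟩ := h₀.axPh i hi
  refine ⟨c, fun j hj => ?_⟩
  obtain ⟨c', hc'⟩ := h₀.axPh j hj
  rcases lt_trichotomy c 0 with hneg | hzero | hpos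
  -- For negative speeds light connection is equality of points, so `c` serves for `j` even if it
  -- differs from `c'`.
  · have hneg' := h₀.neg_of_neg hT hi hj hc hc' hneg
    intro x y
    rw [hc' x y, spaceDist_eq_mul_iff_of_neg h₀.axEField hneg',
      spaceDist_eq_mul_iff_of_neg h₀.axEField hneg]
  · have : c' = 0 := by
      refine (h₀.not_pos_of_nonpos hi hj hc hc' hzero.le).antisymm (not_lt.1 fun h => ?_)
      exact (h₀.neg_of_neg hT hj hi hc' hc h).ne hzero
    rwa [hzero, ← this]
  · have hpos' : 0 < c' :=
      not_le.1 fun h => (h₀.not_pos_of_nonpos hj hi hc' hc h).not_gt hpos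
    rwa [h₀.eq_of_pos hT hD hi hj hc hc' hpos hpos']

theorem IsLightSpeed.eq_of_hasSpeed (hE : ∀ a : Q, 0 < a → ∃ r : Q, a = r ^ 2)
    (h : M.IsLightSpeed i c) {p : B} (hp : p ∈ M.Ph) {v : Q} (hv : M.HasSpeed i p v) : v = c := by
  obtain ⟨-, x, hx, y, hy, hxy, hd⟩ := hv
  have hd' := (h x y).1 ⟨p, hp, hx, hy⟩
  have ht : timeDiff x y ≠ 0 := fun ht => by
    rw [ht, mul_zero] at hd
    exact hxy (eq_of_spaceDist_of_timeDiff hE hd ht)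
  exact mul_right_cancel₀ ht (hd.symm.trans hd')

end LightSignals

end WorldviewModel

theorem proposition5 {B Q : Type*} [Field Q] [LinearOrder Q] [IsStrictOrderedRing Q]
    (M : WorldviewModel B Q) (h₀ : M.SpecRel₀) (hT : M.AxSymTime) (hD : M.AxSymDist) :
    M.AxLightSpeedEq ∧ ∃ c : Q, ∀ i ∈ M.IOb, M.IsLightSpeed i c := by
  obtain ⟨c, hc⟩ := h₀.exists_common_lightSpeed hT hD
  refine ⟨fun i hi j hj p hp v v' hv hv' => ?_, c, hc⟩
  rw [(hc i hi).eq_of_hasSpeed h₀.axEField hp hv, (hc j hj).eq_of_hasSpeed h₀.axEField hp hv']
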